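/- Let $d\ge 1$, $\alpha>d$, $\delta=d/\alpha\in(0,1)$, $\lambda,r_0,\theta,W>0$, $N_0\ge 0$, and let $N\ge 1$ be an integer. A receiver is at the origin of $\mathbb{R}^d$. Its desired transmitter is at a fixed point $x_0$ with $|x_0|=r_0$, and the transmitters are $\Phi=\{x_0\}\cup\{x_1,x_2,\dots\}$, where $\{x_1,x_2,\dots\}$ is a homogeneous Poisson point process of intensity $\lambda$ on $\mathbb{R}^d$ (the typical link of the Poisson bipolar network). The locations are the same in all time slots $k=1,2,\dots$. In slot $k$ transmitter $x_i$ uses a sub-band $\mathcal S_k(x_i)$ that is uniform on $\{1,\dots,N\}$, and the power fading coefficient $h_{k,x_i}$ between $x_i$ and the receiver is exponential with mean $1$ (Rayleigh fading); all these variables are independent of each other and of $\Phi$. Put $$\mathrm{SINR}_k=\frac{h_{k,x_0}r_0^{-\alpha}}{\frac{WN_0}{N}+\sum_{x\in\Phi\setminus\{x_0\}}h_{k,x}|x|^{-\alpha}\mathbf 1(\mathcal S_k(x)=\mathcal S_k(x_0))}.$$ Slot $k$ is successful if $\mathrm{SINR}_k>\theta$. The local delay is the number of time slots until $N$ slots have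 been successful ($\infty$ if this never happens), and $D(N)\in[0,\infty]$ is its expectation. Then, for $N\ge 2$, $$D(N)=N\exp\left(\frac{A}{(N-1)^{1-\delta}N^{\delta}}+\frac{B}{N}\right),$$ where $A=\lambda c_d r_0^d\theta^\delta\,\Gamma(1+\delta)\Gamma(1-\delta)$, $B=\theta r_0^\alpha W N_0$ and $c_d$ is the volume of the unit ball of $\mathbb{R}^d$. Moreover $D(1)=\infty$. -/

import Mathlib

open MeasureTheory ProbabilityTheory
open scoped ENNReal NNReal

namespace FHMA

/-- Number of indices `i` for which the point `X i` of the configuration lies in `B`. -/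
noncomputable def count {Ω E : Type*} (X : ℕ → Ω → E) (B : Set E) (ω : Ω) : ℕ∞ :=
  Set.encard {i : ℕ | X i ω ∈ B}

/-- The random points `X 0, X 1, …` form a homogeneous Poisson point process of intensity `lam`
on `ℝ^d`: the number of points in a Borel set `B` of finite volume is Poisson distributed with
mean `lam * |B|`, and the numbers of points in disjoint such sets are independent.
(For `0 < lam` and `1 ≤ d` the process has almost surely infinitely many points, so that it can be
listed as a sequence; the order of the list is arbitrary.) -/
structure IsPoissonProcess {Ω : Type*} [MeasurableSpace Ω] {d : ℕ}
    (X : ℕ → Ω → EuclideanSpace ℝ (Fin d)) (lam : ℝ≥0) (P : Measure Ω) : Prop where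
  measurable : ∀ i, Measurable (X i)
  count_law : ∀ B : Set (EuclideanSpace ℝ (Fin d)), MeasurableSet B → volume B < ∞ →
    ∀ n : ℕ, P {ω | count X B ω = n} = poissonMeasure (lam * (volume B).toNNReal) {n}
  count_indep : ∀ (m : ℕ) (B : Fin m → Set (EuclideanSpace ℝ (Fin d))),
    (∀ j, MeasurableSet (B j)) → (∀ j, volume (B j) < ∞) →
    Pairwise (fun j l => Disjoint (B j) (B l)) →
    iIndepFun (fun j => count X (B j)) P

/-- The Poisson bipolar network with Rayleigh fading and frequency hopping over `N` sub-bands,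
seen from the typical receiver, which is located at the origin. Transmitters are indexed by `ℕ`.
* `x i` is the location of transmitter `i`. Transmitter `0` is the desired one, located at `x₀`;
  the others form a Poisson process of intensity `lam`.
* `h k i` is the power fading coefficient from transmitter `i` to the receiver in time slot `k`.
* `S k i` is the sub-band used by transmitter `i` in time slot `k`. -/
structure IsNetwork {Ω : Type*} [MeasurableSpace Ω] {d N : ℕ}
    (x : ℕ → Ω → EuclideanSpace ℝ (Fin d)) (h : ℕ → ℕ → Ω → ℝ) (S : ℕ → ℕ → Ω → Fin N)
    (lam : ℝ≥0) (x₀ : EuclideanSpace ℝ (Fin d)) (P : Measure Ω) : Prop where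
  desired : ∀ ω, x 0 ω = x₀
  interferers : IsPoissonProcess (fun i => x (i + 1)) lam P
  measurable_h : ∀ k i, Measurable (h k i)
  measurable_S : ∀ k i, Measurable (S k i)
  law_h : ∀ k i, P.map (h k i) = expMeasure 1
  law_S : ∀ k i (s : Fin N), P {ω | S k i ω = s} = (N : ℝ≥0∞)⁻¹
  indep_h : iIndepFun (fun p : ℕ × ℕ => h p.1 p.2) P
  indep_S : iIndepFun (fun p : ℕ × ℕ => S p.1 p.2) P
  indep_h_S : IndepFun (fun ω (p : ℕ × ℕ) => h p.1 p.2 ω) (fun ω (p : ℕ × ℕ) => S p.1 p.2 ω) P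
  indep_x : IndepFun (fun ω i => x i ω)
    (fun ω => ((fun p : ℕ × ℕ => h p.1 p.2 ω), (fun p : ℕ × ℕ => S p.1 p.2 ω))) P

section

variable {Ω : Type*} {d N : ℕ} (x : ℕ → Ω → EuclideanSpace ℝ (Fin d)) (h : ℕ → ℕ → Ω → ℝ)
  (S : ℕ → ℕ → Ω → Fin N)

/-- Normalized interference at the origin in time slot `k`: the power received from all
transmitters other than the desired one that use the sub-band of the desired one. -/
noncomputable def interference (α : ℝ) (k : ℕ) (ω : Ω) : ℝ≥0∞ :=
  ∑' i : ℕ, if S k (i + 1) ω = S k 0 ω then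
    ENNReal.ofReal (h k (i + 1) ω) * ‖x (i + 1) ω‖ₑ ^ (-α) else 0

/-- Signal-to-interference-plus-noise ratio at the typical receiver in time slot `k`. The noise
power in one of the `N` sub-bands is `W * N₀ / N` (normalized). -/
noncomputable def sinr (α W N₀ : ℝ) (k : ℕ) (ω : Ω) : ℝ≥0∞ :=
  ENNReal.ofReal (h k 0 ω) * ‖x 0 ω‖ₑ ^ (-α) /
    (ENNReal.ofReal (W * N₀ / N) + interference x h S α k ω)

/-- Local delay: the number of time slots until `N` time slots have been successful, where a slot
is successful if the SINR exceeds `θ`. It is `⊤` if this never happens. -/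
noncomputable def localDelay (α W N₀ θ : ℝ) (ω : Ω) : ℕ∞ :=
  ⨅ (n : ℕ) (_ : N ≤ Set.ncard {k : ℕ | k < n ∧ ENNReal.ofReal θ < sinr x h S α W N₀ k ω}),
    (n : ℕ∞)

/-- Mean local delay, with values in `[0, ∞]`. -/
noncomputable def meanLocalDelay [MeasurableSpace Ω] (P : Measure Ω) (α W N₀ θ : ℝ) : ℝ≥0∞ :=
  ∫⁻ ω, (localDelay x h S α W N₀ θ ω : ℝ≥0∞) ∂P

end

/-- Volume of the unit ball of `ℝ^d`. -/
noncomputable def unitBallVolume (d : ℕ) : ℝ :=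
  volume.real (Metric.ball (0 : EuclideanSpace ℝ (Fin d)) 1)

end FHMA

/-! Condition on the positions of the interferers. The slots are then independent with a common
success probability p, so the mean waiting time for N successes is N / p, and the mean local delay
is N times the mean of 1 / p.

Put t(y) = θ r₀^α |y|^(-α). Success means that the desired fading exceeds θ r₀^α times noise plus
interference. The exponential tail turns this into the mean of exp(-noise - interference), which
factorizes over the interferers: one at y contributes (1 - 1/N) + (1/N) / (1 + t(y)), the reciprocal
of 1 + g(y) with g = t / (N + (N - 1) t). Hence 1 / p = exp(B / N) ∏ (1 + g(x_i))
(`infinitePi_interference_lt`).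

The probability generating functional of the Poisson process
(`IsPoissonProcess.lintegral_iSup_prod`) gives the mean of this product as exp(λ ∫ g). For N ≥ 2, g
is bounded and decays like |y|^(-α) with α > d, so the integral is finite; Gamma integrals evaluate
it (`lintegral_pathGain_div`). For N = 1, g = t is not integrable at the origin and the mean is
infinite.

Everything takes values in [0, ∞], with infinite products of factors at least 1 written as suprema
of partial products. Both cases are thus covered by one identity, `IsNetwork.meanLocalDelay_eq`,
without integrability conditions. -/

namespace FHMA

/-! ### The exponential function on `[0, ∞]` -/

/-- The exponential function `[0, ∞] → [0, ∞]`. -/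
noncomputable def eexp (t : ℝ≥0∞) : ℝ≥0∞ := EReal.exp t

lemma eexp_ofReal {t : ℝ} (ht : 0 ≤ t) : eexp (ENNReal.ofReal t) = ENNReal.ofReal (Real.exp t) := by
  rw [eexp, EReal.coe_ennreal_ofReal, max_eq_left ht, EReal.exp_coe]

lemma eexp_zero : eexp 0 = 1 := by simp [eexp]

lemma eexp_top : eexp ⊤ = ⊤ := by simp [eexp]

lemma eexp_add (s t : ℝ≥0∞) : eexp (s + t) = eexp s * eexp t := by
  simp [eexp, EReal.coe_ennreal_add, EReal.exp_add]

lemma eexp_sum {ι : Type*} (s : Finset ι) (f : ι → ℝ≥0∞) :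
    eexp (∑ i ∈ s, f i) = ∏ i ∈ s, eexp (f i) := by
  classical
  induction s using Finset.induction_on with
  | empty => simp [eexp_zero]
  | insert i s hi ih => rw [Finset.sum_insert hi, Finset.prod_insert hi, eexp_add, ih]

lemma eexp_mono : Monotone eexp := fun _ _ h =>
  EReal.exp_monotone (EReal.coe_ennreal_le_coe_ennreal_iff.2 h)

lemma continuous_eexp : Continuous eexp := by
  have := EReal.expHomeomorph.continuous
  exact this.comp continuous_coe_ennreal_ereal

lemma eexp_iSup {ι : Type*} [Nonempty ι] (f : ι → ℝ≥0∞) : eexp (⨆ i, f i) = ⨆ i, eexp (f i) :=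
  eexp_mono.map_ciSup_of_continuousAt continuous_eexp.continuousAt (OrderTop.bddAbove _)

/-! ### Suprema of monotone products -/

/-- Multiplication on [0, ∞] is discontinuous only where 0 meets ∞; the bound `1 ≤ f i n` keeps all
limits away from 0. -/
lemma iSup_finset_prod {ι : Type*} (s : Finset ι) (f : ι → ℕ → ℝ≥0∞) (hf : ∀ i, Monotone (f i))
    (h1 : ∀ i n, 1 ≤ f i n) :
    ⨆ n, ∏ i ∈ s, f i n = ∏ i ∈ s, ⨆ n, f i n := by
  classical
  have hm : Monotone fun n => ∏ i ∈ s, f i n := fun a b hab =>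
    Finset.prod_le_prod' fun i _ => hf i hab
  refine tendsto_nhds_unique (tendsto_atTop_iSup hm) ?_
  clear hm
  induction s using Finset.induction_on with
  | empty => simp
  | insert i s hi ih =>
    simp only [Finset.prod_insert hi]
    have hs : ∀ t : Finset ι, ∏ i ∈ t, ⨆ n, f i n ≠ 0 := fun t =>
      Finset.prod_ne_zero_iff.2 fun i _ =>
        (zero_lt_one.trans_le ((h1 i 0).trans (le_iSup (f i) 0))).ne'
    refine ENNReal.Tendsto.mul (tendsto_atTop_iSup (hf i)) (.inl ?_) ih (.inl (hs s))
    simpa using hs {i}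

/-! ### Generating functional of a Poisson process -/

lemma tsum_poissonMeasure_mul_pow (r a : ℝ≥0) :
    ∑' n : ℕ, poissonMeasure r {n} * (1 + a : ℝ≥0∞) ^ n = eexp (r * a) := by
  have h1 : ∀ n : ℕ, poissonMeasure r {n} * (1 + a : ℝ≥0∞) ^ n =
      ENNReal.ofReal (Real.exp (-r) * ((r * (1 + a)) ^ n / n.factorial)) := by
    intro n
    rw [poissonMeasure_singleton, show (1 + a : ℝ≥0∞) = ENNReal.ofReal (1 + (a : ℝ)) by
      rw [ENNReal.ofReal_add zero_le_one a.coe_nonneg]; simp, ← ENNReal.ofReal_pow (by positivity),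
      ← ENNReal.ofReal_mul (by positivity)]
    congr 1
    rw [mul_pow]; ring
  have h2 : HasSum (fun n : ℕ => Real.exp (-r) * ((r * (1 + a) : ℝ) ^ n / n.factorial))
      (Real.exp (-r) * Real.exp (r * (1 + a))) := by
    have := NormedSpace.expSeries_div_hasSum_exp (𝔸 := ℝ) (r * (1 + a) : ℝ)
    rw [← Real.exp_eq_exp_ℝ] at this
    exact this.mul_left _
  simp_rw [h1]
  rw [← ENNReal.ofReal_tsum_of_nonneg (fun n => by positivity) h2.summable, h2.tsum_eq,
    ← Real.exp_add, show (r * a : ℝ≥0∞) = ENNReal.ofReal (r * a : ℝ) by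
      rw [ENNReal.ofReal_mul r.coe_nonneg]; simp, eexp_ofReal (by positivity)]
  congr 2; ring

section

variable {Ω E : Type*}

lemma measurable_count [MeasurableSpace Ω] [MeasurableSpace E] {X : ℕ → Ω → E}
    (hX : ∀ i, Measurable (X i)) {B : Set E} (hB : MeasurableSet B) :
    Measurable (count X B) :=
  measurable_encard.comp (measurable_set_iff.2 fun i => measurable_to_prop (by
    have : (fun ω => i ∈ {i | X i ω ∈ B}) ⁻¹' {True} = X i ⁻¹' B := by ext; simp
    rw [this]; exact hX i hB))

/-- The partial products become constant once n passes the last index whose point lies in `B`.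
Finiteness matters because `toNat` sends `⊤` to 0. -/
lemma iSup_prod_indicator_eq_pow (X : ℕ → Ω → E) (B : Set E) (ω : Ω) (hfin : count X B ω ≠ ⊤)
    (a : ℝ≥0∞) :
    ⨆ n, ∏ i ∈ Finset.range n, (1 + B.indicator (fun _ => a) (X i ω)) =
      (1 + a) ^ (count X B ω).toNat := by
  classical
  set s : Set ℕ := {i | X i ω ∈ B} with hs
  have hsf : s.Finite := Set.encard_ne_top_iff.1 hfin
  have hc : (count X B ω).toNat = hsf.toFinset.card := by
    rw [← Set.ncard_eq_toFinset_card s hsf]; rfl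
  have hp : ∀ n, ∏ i ∈ Finset.range n, (1 + B.indicator (fun _ => a) (X i ω)) =
      (1 + a) ^ ((Finset.range n).filter (· ∈ s)).card := by
    intro n
    rw [Finset.card_filter, ← Finset.prod_pow_eq_pow_sum]
    refine Finset.prod_congr rfl fun i _ => ?_
    by_cases h : X i ω ∈ B <;> simp [hs, h]
  simp_rw [hp, hc]
  refine le_antisymm (iSup_le fun n => ?_) ?_
  · refine pow_le_pow_right₀ le_self_add (Finset.card_le_card fun i hi => ?_)
    simpa using (Finset.mem_filter.1 hi).2
  · obtain ⟨n, hn⟩ := hsf.bddAbove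
    refine le_iSup_of_le (n + 1) (pow_le_pow_right₀ le_self_add (Finset.card_le_card fun i hi => ?_))
    have hi' : i ∈ s := by simpa using hi
    exact Finset.mem_filter.2 ⟨Finset.mem_range.2 (Nat.lt_succ_of_le (hn hi')), hi'⟩

end

namespace IsPoissonProcess

variable {Ω : Type*} [MeasurableSpace Ω] {d : ℕ} {X : ℕ → Ω → EuclideanSpace ℝ (Fin d)}
  {lam : ℝ≥0} {P : Measure Ω} [IsProbabilityMeasure P]

/-- The Poisson weights of the finite values already sum to one, leaving no mass for `⊤`. -/
lemma ae_count_ne_top (hX : IsPoissonProcess X lam P) {B : Set (EuclideanSpace ℝ (Fin d))}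
    (hB : MeasurableSet B) (hvB : volume B < ∞) : ∀ᵐ ω ∂P, count X B ω ≠ ⊤ := by
  have hm := measurable_count hX.measurable hB
  have hms : ∀ n : ℕ, MeasurableSet {ω | count X B ω = n} := fun n => hm (measurableSet_singleton _)
  have h : P (⋃ n : ℕ, {ω | count X B ω = n}) = 1 := by
    rw [measure_iUnion ?_ hms]
    · rw [tsum_congr fun n => hX.count_law B hB hvB n]
      have := measure_iUnion (μ := poissonMeasure (lam * (volume B).toNNReal))
        (f := fun n : ℕ => ({n} : Set ℕ)) (fun i j hij => by simpa using hij)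
        (fun _ => measurableSet_singleton _)
      rw [← this]
      rw [Set.iUnion_of_singleton, measure_univ]
    · intro i j hij
      refine Set.disjoint_left.2 fun ω hi hj => hij ?_
      simp only [Set.mem_ofPred_eq] at hi hj
      exact_mod_cast hi.symm.trans hj
  have := (prob_compl_eq_zero_iff (MeasurableSet.iUnion hms)).2 h
  refine measure_mono_null (fun ω hω => ?_) this
  simp only [Set.mem_compl_iff, Set.mem_iUnion, Set.mem_ofPred_eq, not_exists] at hω ⊢
  intro n hn
  simp [hn] at hω

lemma lintegral_pow_count (hX : IsPoissonProcess X lam P) {B : Set (EuclideanSpace ℝ (Fin d))}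
    (hB : MeasurableSet B) (hvB : volume B < ∞) (a : ℝ≥0) :
    ∫⁻ ω, (1 + a : ℝ≥0∞) ^ (count X B ω).toNat ∂P = eexp (lam * (a * volume B)) := by
  have hm := measurable_count hX.measurable hB
  have hm' : Measurable fun ω => (count X B ω).toNat := Measurable.of_discrete.comp hm
  have hmap : ∀ n : ℕ, P.map (fun ω => (count X B ω).toNat) {n} =
      poissonMeasure (lam * (volume B).toNNReal) {n} := by
    intro n
    rw [Measure.map_apply hm' (measurableSet_singleton _), ← hX.count_law B hB hvB]
    refine measure_congr ?_
    filter_upwards [hX.ae_count_ne_top hB hvB] with ω hω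
    refine propext ?_
    change (count X B ω).toNat = n ↔ count X B ω = n
    constructor
    · rintro rfl; exact (ENat.natCast_toNat hω).symm
    · intro h; rw [h]; rfl
  have := lintegral_map (μ := P) (f := fun n : ℕ => (1 + a : ℝ≥0∞) ^ n) Measurable.of_discrete hm'
  rw [← this, lintegral_countable']
  simp_rw [hmap, mul_comm _ (poissonMeasure _ _), tsum_poissonMeasure_mul_pow]
  congr 1
  rw [ENNReal.coe_mul, ENNReal.coe_toNNReal hvB.ne]; ring

/-- The probability generating functional of a Poisson process, for a simple function. -/
lemma lintegral_iSup_prod_sum_indicator (hX : IsPoissonProcess X lam P) {m : ℕ}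
    {B : Fin m → Set (EuclideanSpace ℝ (Fin d))} (hB : ∀ j, MeasurableSet (B j))
    (hvB : ∀ j, volume (B j) < ∞) (hd : Pairwise fun j l => Disjoint (B j) (B l))
    (a : Fin m → ℝ≥0) :
    ∫⁻ ω, ⨆ n, ∏ i ∈ Finset.range n,
        (1 + ∑ j, (B j).indicator (fun _ => (a j : ℝ≥0∞)) (X i ω)) ∂P =
      eexp (lam * ∑ j, a j * volume (B j)) := by
  -- By disjointness at most one summand is nonzero, so the sum becomes a product over the cells;
  -- independence of the cell counts can then be used.
  have hprod : ∀ y, (1 + ∑ j, (B j).indicator (fun _ => (a j : ℝ≥0∞)) y) =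
      ∏ j, (1 + (B j).indicator (fun _ => (a j : ℝ≥0∞)) y) := by
    intro y
    by_cases hy : ∃ j, y ∈ B j
    · obtain ⟨j, hj⟩ := hy
      have hne : ∀ l, l ≠ j → y ∉ B l := fun l hl hyl => Set.disjoint_left.1 (hd hl) hyl hj
      rw [Finset.sum_eq_single j (fun l _ hl => Set.indicator_of_notMem (hne l hl) _) (by simp),
        Finset.prod_eq_single j (fun l _ hl => by simp [Set.indicator_of_notMem (hne l hl)])
          (by simp)]
    · push Not at hy
      simp [Set.indicator_of_notMem (hy _)]
  have hae : ∀ᵐ ω ∂P, (⨆ n, ∏ i ∈ Finset.range n,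
        (1 + ∑ j, (B j).indicator (fun _ => (a j : ℝ≥0∞)) (X i ω))) =
      ∏ j, (1 + a j : ℝ≥0∞) ^ (count X (B j) ω).toNat := by
    filter_upwards [ae_all_iff.2 fun j => hX.ae_count_ne_top (hB j) (hvB j)] with ω hω
    simp_rw [hprod]
    simp_rw [Finset.prod_comm (s := Finset.range _)]
    rw [iSup_finset_prod]
    · exact Finset.prod_congr rfl fun j _ => iSup_prod_indicator_eq_pow X (B j) ω (hω j) _
    · intro j
      exact monotone_nat_of_le_succ fun n => by
        rw [Finset.prod_range_succ]; exact le_mul_of_one_le_right' le_self_add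
    · intro j n
      exact Finset.one_le_prod' fun i _ => le_self_add
  rw [lintegral_congr_ae hae, lintegral_prod_eq_prod_lintegral_of_indepFun Finset.univ
    (fun j ω => (1 + a j : ℝ≥0∞) ^ (count X (B j) ω).toNat)
    ((hX.count_indep m B hB hvB hd).comp (fun j k => (1 + a j : ℝ≥0∞) ^ k.toNat)
      fun j => Measurable.of_discrete)
    (fun j => (Measurable.of_discrete (f := fun k : ℕ∞ => (1 + a j : ℝ≥0∞) ^ k.toNat)).comp
      (measurable_count hX.measurable (hB j)))]
  simp_rw [hX.lintegral_pow_count (hB _) (hvB _), ← eexp_sum, Finset.mul_sum]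

/-- The level sets of `F` inside `K` are disjoint cells of finite volume, which reduces this to a
finite sum of indicators. -/
lemma lintegral_iSup_prod_indicator_simpleFunc (hX : IsPoissonProcess X lam P)
    (F : SimpleFunc (EuclideanSpace ℝ (Fin d)) ℝ≥0∞) (hF : ∀ y, F y < ∞)
    {K : Set (EuclideanSpace ℝ (Fin d))} (hK : MeasurableSet K) (hvK : volume K < ∞) :
    ∫⁻ ω, ⨆ n, ∏ i ∈ Finset.range n, (1 + K.indicator F (X i ω)) ∂P =
      eexp (lam * ∫⁻ y in K, F y) := by
  classical
  let e := F.range.equivFin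
  let v : Fin F.range.card → ℝ≥0∞ := fun j => (e.symm j : ℝ≥0∞)
  have hv : ∀ j, v j ≠ ∞ := fun j => by
    obtain ⟨y, hy⟩ := SimpleFunc.mem_range.1 (e.symm j).2
    change (e.symm j : ℝ≥0∞) ≠ ∞
    rw [← hy]; exact (hF y).ne
  have hvi : Function.Injective v := fun j l h => e.symm.injective (Subtype.ext h)
  have hB : ∀ j, MeasurableSet (F ⁻¹' {v j} ∩ K) := fun j =>
    (F.measurableSet_fiber _).inter hK
  have hind : ∀ y, K.indicator F y = ∑ j, (F ⁻¹' {v j} ∩ K).indicator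
      (fun _ => ((v j).toNNReal : ℝ≥0∞)) y := by
    intro y
    by_cases hy : y ∈ K
    · have hvy : v (e ⟨F y, SimpleFunc.mem_range_self F y⟩) = F y := by simp [v]
      rw [Finset.sum_eq_single (e ⟨F y, SimpleFunc.mem_range_self F y⟩) _ (by simp),
        Set.indicator_of_mem hy, Set.indicator_of_mem
          (show y ∈ F ⁻¹' {v _} ∩ K from ⟨hvy.symm, hy⟩), ENNReal.coe_toNNReal (hv _),
        hvy]
      intro l _ hl
      refine Set.indicator_of_notMem (fun h => hl (hvi ?_)) _
      rw [hvy]; exact h.1.symm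
    · simp [hy]
  simp_rw [hind]
  rw [hX.lintegral_iSup_prod_sum_indicator hB
    (fun j => (measure_mono Set.inter_subset_right).trans_lt hvK) ?_, SimpleFunc.lintegral_eq_lintegral, SimpleFunc.lintegral]
  · congr 2
    rw [← Finset.sum_coe_sort F.range, ← e.symm.sum_comp]
    refine Finset.sum_congr rfl fun j _ => ?_
    rw [ENNReal.coe_toNNReal (hv _), Measure.restrict_apply (F.measurableSet_fiber _)]
  · intro j l hjl
    refine Set.disjoint_left.2 fun y hj hl => hjl (hvi ?_)
    exact hj.1.symm.trans hl.1

/-- The probability generating functional of a Poisson process. -/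
theorem lintegral_iSup_prod (hX : IsPoissonProcess X lam P)
    {g : EuclideanSpace ℝ (Fin d) → ℝ≥0∞} (hg : Measurable g) :
    ∫⁻ ω, ⨆ n, ∏ i ∈ Finset.range n, (1 + g (X i ω)) ∂P = eexp (lam * ∫⁻ y, g y) := by
  -- Cutting off to balls gives finite volume, and `eapprox` takes finite values. Since `G`
  -- increases to `g`, monotone convergence passes to the limit.
  let G : ℕ → EuclideanSpace ℝ (Fin d) → ℝ≥0∞ := fun m =>
    (Metric.ball 0 m).indicator (SimpleFunc.eapprox g m)
  have hGm : Monotone G := fun m k hmk y => by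
    have hmk' : (m : ℝ) ≤ k := by exact_mod_cast hmk
    refine (Set.indicator_le_indicator_of_subset (Metric.ball_subset_ball hmk')
      (fun _ => zero_le) y).trans ?_
    exact Set.indicator_le_indicator (SimpleFunc.monotone_eapprox g hmk y)
  have hGmeas : ∀ m, Measurable (G m) := fun m =>
    (SimpleFunc.measurable _).indicator Metric.isOpen_ball.measurableSet
  have hGs : ∀ y, ⨆ m, G m y = g y := by
    intro y
    refine le_antisymm (iSup_le fun m => ?_) ?_
    · refine (Set.indicator_le_self _ _ y).trans ?_
      rw [← SimpleFunc.iSup_eapprox_apply hg y]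
      exact le_iSup (fun m => SimpleFunc.eapprox g m y) m
    · rw [← SimpleFunc.iSup_eapprox_apply hg y]
      refine iSup_le fun m => ?_
      obtain ⟨k, hk⟩ := exists_nat_gt ‖y‖
      refine le_iSup_of_le (max m k) ?_
      have : y ∈ Metric.ball (0 : EuclideanSpace ℝ (Fin d)) (max m k : ℕ) := by
        rw [mem_ball_zero_iff]
        exact hk.trans_le (by exact_mod_cast le_max_right m k)
      change _ ≤ (Metric.ball 0 ((max m k : ℕ) : ℝ)).indicator _ y
      rw [Set.indicator_of_mem this]
      exact SimpleFunc.monotone_eapprox g (le_max_left m k) y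
  have hprod : ∀ ω, (⨆ n, ∏ i ∈ Finset.range n, (1 + g (X i ω))) =
      ⨆ m, ⨆ n, ∏ i ∈ Finset.range n, (1 + G m (X i ω)) := by
    intro ω
    rw [iSup_comm]
    refine iSup_congr fun n => ?_
    rw [iSup_finset_prod]
    · simp_rw [← ENNReal.add_iSup, hGs]
    · exact fun i m k hmk => add_le_add_right (hGm hmk _) _
    · exact fun i m => le_self_add
  simp_rw [hprod]
  rw [lintegral_iSup]
  · have : ∀ m, ∫⁻ ω, ⨆ n, ∏ i ∈ Finset.range n, (1 + G m (X i ω)) ∂P =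
        eexp (lam * ∫⁻ y, G m y) := fun m => by
      rw [hX.lintegral_iSup_prod_indicator_simpleFunc _ (SimpleFunc.eapprox_lt_top g m)
        Metric.isOpen_ball.measurableSet measure_ball_lt_top,
        lintegral_indicator Metric.isOpen_ball.measurableSet]
    simp_rw [this]
    rw [← eexp_iSup, ← ENNReal.mul_iSup, ← lintegral_iSup hGmeas hGm]
    simp_rw [hGs]
  · exact fun m => Measurable.iSup fun n => Finset.measurable_prod _ fun i _ =>
      ((hGmeas m).comp (hX.measurable i)).const_add _
  · exact fun m k hmk ω => iSup_mono fun n => Finset.prod_le_prod' fun i _ =>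
      add_le_add_right (hGm hmk _) _

end IsPoissonProcess

/-! ### Waiting time for the N-th success -/

lemma ncard_lt_and_eq_count (p : ℕ → Prop) [DecidablePred p] (n : ℕ) :
    Set.ncard {k : ℕ | k < n ∧ p k} = Nat.count p n := by
  rw [Nat.count_eq_card_filter_range, ← Set.ncard_coe_finset]
  congr 1
  ext k; simp

/-- A success contributes exactly when fewer than N successes precede it, so precisely the first N
successes are counted. -/
lemma tsum_ite_count_lt (p : ℕ → Prop) [DecidablePred p] (hp : {k | p k}.Infinite) (N : ℕ) :
    ∑' n, (if Nat.count p n < N ∧ p n then 1 else 0 : ℝ≥0∞) = N := by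
  have h : ∀ n, ∑ k ∈ Finset.range n, (if Nat.count p k < N ∧ p k then 1 else 0 : ℝ≥0∞) =
      (min N (Nat.count p n) : ℕ) := by
    intro n
    induction n with
    | zero => simp
    | succ n ih =>
      rw [Finset.sum_range_succ, ih, Nat.count_succ]
      by_cases hn : p n <;> by_cases hc : Nat.count p n < N
      · simp only [hn, hc, and_self, if_true]
        rw [min_eq_right hc.le, min_eq_right hc]; push_cast; rfl
      · simp only [hn, hc, false_and, if_false, if_true]
        rw [min_eq_left (by omega), min_eq_left (by omega), add_zero]
      · simp [hn]
      · simp [hn]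
  rw [ENNReal.tsum_eq_iSup_nat]
  simp_rw [h]
  refine le_antisymm (iSup_le fun n => by exact_mod_cast min_le_left _ _) ?_
  -- `Nat.nth` is indexed from zero, so exactly N successes lie strictly before this index.
  refine le_iSup_of_le (Nat.nth p N) ?_
  rw [Nat.count_nth_of_infinite hp, min_self]

section

variable {Ω : Type*} [MeasurableSpace Ω] {P : Measure Ω} [IsProbabilityMeasure P]

open scoped Classical in
lemma measurable_natCount {A : ℕ → Set Ω} (hA : ∀ k, MeasurableSet (A k)) (n : ℕ) :
    Measurable fun ω => Nat.count (fun k => ω ∈ A k) n := by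
  simp_rw [Nat.count_eq_card_filter_range, Finset.card_filter]
  exact Finset.measurable_sum _ fun k _ => Measurable.ite (hA k) measurable_const measurable_const

open scoped Classical in
/-- The mean number of independent trials with success probability `p` until the `N`-th success
is `N / p`. -/
lemma tsum_measure_count_lt {A : ℕ → Set Ω} (hA : ∀ k, MeasurableSet (A k))
    (hind : iIndepSet A P) {p : ℝ≥0∞} (hp : ∀ k, P (A k) = p) {N : ℕ} (hN : N ≠ 0) :
    ∑' n, P {ω | Nat.count (fun k => ω ∈ A k) n < N} = N * p⁻¹ := by
  have hm := measurable_natCount hA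
  have hms : ∀ n, MeasurableSet {ω | Nat.count (fun k => ω ∈ A k) n < N} := fun n =>
    hm n measurableSet_Iio
  -- With p = 0 there is almost surely no success: every term is 1, and both sides are infinite
  -- because N ≠ 0.
  by_cases hp0 : p = 0
  · have hone : ∀ n, P {ω | Nat.count (fun k => ω ∈ A k) n < N} = 1 := by
      intro n
      have : ∀ᵐ ω ∂P, ∀ k, ω ∉ A k := ae_all_iff.2 fun k => by
        rw [ae_iff]; simpa [hp0] using hp k
      refine (mem_ae_iff_prob_eq_one (hms n)).1 ?_
      filter_upwards [this] with ω hω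
      have : Nat.count (fun k => ω ∈ A k) n = 0 := by
        rw [Nat.count_eq_card_filter_range]; simp [hω]
      change Nat.count (fun k => ω ∈ A k) n < N
      omega
    simp_rw [hone, hp0, ENNReal.inv_zero]
    rw [ENNReal.mul_top (by exact_mod_cast hN), ENNReal.tsum_const_eq_top_of_ne_zero one_ne_zero]
  have hptop : p ≠ ∞ := by rw [← hp 0]; exact measure_ne_top _ _
  -- Second Borel–Cantelli lemma.
  have hinf : ∀ᵐ ω ∂P, {k | ω ∈ A k}.Infinite := by
    have h1 := measure_limsup_eq_one hA hind (by
      simp_rw [hp]; exact ENNReal.tsum_const_eq_top_of_ne_zero hp0)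
    filter_upwards [(mem_ae_iff_prob_eq_one (MeasurableSet.measurableSet_limsup hA)).2 h1] with ω hω
    rw [Set.Infinite]
    have := Filter.mem_limsup_iff_frequently_mem.1 hω
    rwa [Nat.frequently_atTop_iff_infinite] at this
  have hindep : ∀ n, P ({ω | Nat.count (fun k => ω ∈ A k) n < N} ∩ A n) =
      P {ω | Nat.count (fun k => ω ∈ A k) n < N} * p := by
    intro n
    have hf : iIndepFun (fun k => (A k).indicator fun _ : Ω => (1 : ℕ)) P :=
      hind.iIndepFun_indicator
    have := hf.indepFun_sum_range_succ (fun k => measurable_const.indicator (hA k)) n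
    have h2 := this.measure_inter_preimage_eq_mul (Set.Iio N) {1} measurableSet_Iio
      (measurableSet_singleton _)
    have e1 : (A n).indicator (fun _ : Ω => (1 : ℕ)) ⁻¹' {1} = A n := by
      ext ω; by_cases h : ω ∈ A n <;> simp [h]
    have e2 : (∑ k ∈ Finset.range n, (A k).indicator fun _ : Ω => (1 : ℕ)) ⁻¹' Set.Iio N =
        {ω | Nat.count (fun k => ω ∈ A k) n < N} := by
      ext ω
      simp only [Set.mem_preimage, Finset.sum_apply, Set.mem_Iio, Set.mem_ofPred_eq,
        Nat.count_eq_card_filter_range, Finset.card_filter, Set.indicator_apply]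
    rwa [e1, e2, hp] at h2
  -- Whether fewer than N successes precede slot n is independent of slot n. Multiplying each term
  -- by p therefore yields the mean number of successes among the first N, which is N.
  have hsum : (∑' n, P {ω | Nat.count (fun k => ω ∈ A k) n < N}) * p = N := by
    rw [← ENNReal.tsum_mul_right]
    simp_rw [← hindep]
    have : ∀ n, P ({ω | Nat.count (fun k => ω ∈ A k) n < N} ∩ A n) =
        ∫⁻ ω, (if Nat.count (fun k => ω ∈ A k) n < N ∧ ω ∈ A n then 1 else 0) ∂P := by
      intro n
      rw [← lintegral_indicator_one ((hms n).inter (hA n))]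
      refine lintegral_congr fun ω => ?_
      simp [Set.indicator_apply]
    simp_rw [this]
    have hmi : ∀ n, Measurable fun ω =>
        (if Nat.count (fun k => ω ∈ A k) n < N ∧ ω ∈ A n then 1 else 0 : ℝ≥0∞) := fun n =>
      Measurable.ite ((hms n).inter (hA n)) measurable_const measurable_const
    rw [← lintegral_tsum fun n => (hmi n).aemeasurable]
    rw [lintegral_congr_ae (g := fun _ => (N : ℝ≥0∞)) ?_]
    · simp
    · filter_upwards [hinf] with ω hω
      exact tsum_ite_count_lt _ hω N
  rw [← hsum, mul_assoc, ENNReal.mul_inv_cancel hp0 hptop, mul_one]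

end

/-! ### Independence of pairs, sequences and arrays -/

section

variable {Ω : Type*} [MeasurableSpace Ω] {P : Measure Ω}

/-- Two families of independent variables that are independent of each other give an independent
family of pairs. -/
lemma iIndepFun_prodMk {ι : Type*} {β γ : ι → Type*} [∀ i, MeasurableSpace (β i)]
    [∀ i, MeasurableSpace (γ i)] {f : ∀ i, Ω → β i} {g : ∀ i, Ω → γ i}
    (hf : ∀ i, Measurable (f i)) (hg : ∀ i, Measurable (g i))
    (hfi : iIndepFun f P) (hgi : iIndepFun g P)
    (hfg : IndepFun (fun ω i => f i ω) (fun ω i => g i ω) P) :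
    iIndepFun (fun i ω => (f i ω, g i ω)) P := by
  let π : ι → Set (Set Ω) := fun i =>
    (fun s : Set (β i × γ i) => (fun ω => (f i ω, g i ω)) ⁻¹' s) ''
      Set.image2 (· ×ˢ ·) {s : Set (β i) | MeasurableSet s} {t : Set (γ i) | MeasurableSet t}
  refine iIndepSets.iIndep (m := fun i => MeasurableSpace.comap (fun ω => (f i ω, g i ω)) inferInstance)
    (fun i => ((hf i).prodMk (hg i)).comap_le) π ?_ ?_ ?_
  · intro i
    exact isPiSystem_prod.comap _
  · intro i
    change MeasurableSpace.comap _ Prod.instMeasurableSpace = _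
    rw [← generateFrom_prod, MeasurableSpace.comap_generateFrom]
  · rw [iIndepSets_iff]
    intro S u hu
    -- The sets of the π-system are preimages of rectangles. Empty sets are chosen outside `S` so
    -- that the choice is defined for every index.
    have : ∀ i, ∃ s : Set (β i), ∃ t : Set (γ i), MeasurableSet s ∧ MeasurableSet t ∧
        (i ∈ S → u i = f i ⁻¹' s ∩ g i ⁻¹' t) := by
      intro i
      by_cases hi : i ∈ S
      · obtain ⟨_, ⟨s, hs, t, ht, rfl⟩, h⟩ := hu i hi
        refine ⟨s, t, hs, ht, fun _ => ?_⟩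
        rw [← h]; rfl
      · exact ⟨∅, ∅, .empty, .empty, fun h => absurd h hi⟩
    choose s t hs ht hst using this
    have e1 : (⋂ i ∈ S, u i) = (fun ω i => f i ω) ⁻¹' (Set.pi S s) ∩
        (fun ω i => g i ω) ⁻¹' (Set.pi S t) := by
      ext ω
      simp only [Set.mem_iInter, Set.mem_inter_iff, Set.mem_preimage, Set.mem_pi,
        Finset.mem_coe]
      constructor
      · intro h
        exact ⟨fun i hi => (by have := h i hi; rw [hst i hi] at this; exact this.1),
          fun i hi => (by have := h i hi; rw [hst i hi] at this; exact this.2)⟩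
      · rintro ⟨h1, h2⟩ i hi
        rw [hst i hi]; exact ⟨h1 i hi, h2 i hi⟩
    have e2 : (fun ω i => f i ω) ⁻¹' (Set.pi S s) = ⋂ i ∈ S, f i ⁻¹' s i := by
      ext ω; simp [Set.mem_pi]
    have e3 : (fun ω i => g i ω) ⁻¹' (Set.pi S t) = ⋂ i ∈ S, g i ⁻¹' t i := by
      ext ω; simp [Set.mem_pi]
    rw [e1, hfg.measure_inter_preimage_eq_mul _ _ (.pi S.countable_toSet fun i _ => hs i)
      (.pi S.countable_toSet fun i _ => ht i), e2, e3,
      hfi.measure_inter_preimage_eq_mul S fun i _ => hs i,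
      hgi.measure_inter_preimage_eq_mul S fun i _ => ht i, ← Finset.prod_mul_distrib]
    refine Finset.prod_congr rfl fun i hi => ?_
    rw [hst i hi]
    exact ((hfg.comp (measurable_pi_apply i) (measurable_pi_apply i)).measure_inter_preimage_eq_mul
      _ _ (hs i) (ht i)).symm

end

/-- A sequence with an infinite product law splits into an independent head and tail. -/
lemma infinitePi_map_head_tail {β : Type*} [MeasurableSpace β] (ρ : Measure β)
    [IsProbabilityMeasure ρ] :
    (Measure.infinitePi fun _ : ℕ => ρ).map (fun z => (z 0, fun i => z (i + 1))) =
      ρ.prod (Measure.infinitePi fun _ : ℕ => ρ) := by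
  have hind : iIndepFun (fun (i : ℕ) (z : ℕ → β) => z i) (Measure.infinitePi fun _ : ℕ => ρ) :=
    iIndepFun_infinitePi (X := fun _ b => b) fun _ => measurable_id
  have hdisj : Indep _ _ _ := indep_iSup_of_disjoint (fun i => (measurable_pi_apply i).comap_le)
    hind.iIndep (S := {0}) (T := {0}ᶜ) disjoint_compl_right
  have hht : IndepFun (fun z : ℕ → β => z 0) (fun z i => z (i + 1))
      (Measure.infinitePi fun _ : ℕ => ρ) := by
    refine indep_of_indep_of_le_left (indep_of_indep_of_le_right hdisj ?_) ?_
    · rw [MeasurableSpace.pi, MeasurableSpace.comap_iSup]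
      refine iSup_le fun i => ?_
      rw [MeasurableSpace.comap_comp]
      exact le_iSup₂_of_le (i + 1) (by simp) le_rfl
    · exact le_iSup₂_of_le 0 rfl le_rfl
  have hm : Measurable fun (z : ℕ → β) (i : ℕ) => z (i + 1) :=
    measurable_pi_iff.2 fun i => measurable_pi_apply (i + 1)
  rw [(indepFun_iff_map_prod_eq_prod_map_map (measurable_pi_apply 0).aemeasurable
      hm.aemeasurable).1 hht,
    Measure.infinitePi_map_eval, Measure.map_infinitePi_infinitePi_of_inj (add_left_injective 1)]

/-- The rows of an independent identically distributed array are independent and have a product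
law. -/
lemma map_curry_eq_infinitePi {Ω β : Type*} [MeasurableSpace Ω] [MeasurableSpace β] {P : Measure Ω}
    [IsProbabilityMeasure P] {ρ : Measure β} [IsProbabilityMeasure ρ] {Z : ℕ × ℕ → Ω → β}
    (hm : ∀ p, Measurable (Z p)) (hind : iIndepFun Z P) (hlaw : ∀ p, P.map (Z p) = ρ) :
    P.map (fun ω k i => Z (k, i) ω) =
      Measure.infinitePi fun _ : ℕ => Measure.infinitePi fun _ : ℕ => ρ := by
  rw [← Measure.infinitePi_map_curry (fun _ _ : ℕ => ρ)]
  have h := (iIndepFun_iff_map_fun_eq_infinitePi_map hm).1 hind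
  simp_rw [hlaw] at h
  rw [← h, Measure.map_map (by fun_prop) (by fun_prop)]
  rfl

/-! ### Exponential fading -/

lemma expMeasure_lt_ofReal (I : ℝ≥0∞) :
    expMeasure 1 {r | I < ENNReal.ofReal r} = (eexp I)⁻¹ := by
  have : IsProbabilityMeasure (expMeasure 1) := isProbabilityMeasure_expMeasure one_pos
  induction I with
  | top => simp [eexp_top]
  | coe I =>
    have e : {r : ℝ | (I : ℝ≥0∞) < ENNReal.ofReal r} = (Set.Iic (I : ℝ))ᶜ := by
      ext r
      simp [ENNReal.lt_ofReal_iff_toReal_lt]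
    have h := cdf_expMeasure_eq one_pos (I : ℝ)
    rw [cdf_eq_real, if_pos I.coe_nonneg, one_mul] at h
    rw [e, prob_compl_eq_one_sub measurableSet_Iic, ← ofReal_measureReal, h,
      ← ENNReal.ofReal_one, ← ENNReal.ofReal_sub _ (by simp), sub_sub_cancel,
      ← ENNReal.ofReal_coe_nnreal, eexp_ofReal I.coe_nonneg,
      ← ENNReal.ofReal_inv_of_pos (Real.exp_pos _), Real.exp_neg]

lemma one_le_eexp (t : ℝ≥0∞) : 1 ≤ eexp t := by rw [← eexp_zero]; exact eexp_mono bot_le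

lemma eexp_ne_zero (t : ℝ≥0∞) : eexp t ≠ 0 := (zero_lt_one.trans_le (one_le_eexp t)).ne'

lemma measurable_eexp : Measurable eexp := continuous_eexp.measurable

/-- Tilting the rate-1 exponential density by exp(-rt) gives (1 + t)⁻¹ times the density of rate 1 +
t, whose total mass is one. -/
lemma lintegral_expMeasure_inv_eexp (t : ℝ≥0) :
    ∫⁻ r, (eexp (ENNReal.ofReal r * t))⁻¹ ∂expMeasure 1 = (1 + t : ℝ≥0∞)⁻¹ := by
  have hm : Measurable fun r : ℝ => (eexp (ENNReal.ofReal r * t))⁻¹ :=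
    (measurable_eexp.comp (ENNReal.measurable_ofReal.mul_const _)).inv
  have ht : (0 : ℝ) < 1 + t := by positivity
  have hpdf : ∀ r : ℝ, exponentialPDF 1 r * (eexp (ENNReal.ofReal r * t))⁻¹ =
      (1 + t : ℝ≥0∞)⁻¹ * exponentialPDF (1 + t) r := by
    intro r
    rcases lt_or_ge r 0 with hr | hr
    · simp [exponentialPDF_of_neg hr]
    · rw [exponentialPDF_of_nonneg hr, exponentialPDF_of_nonneg hr, ← ENNReal.ofReal_coe_nnreal,
        ← ENNReal.ofReal_mul hr, eexp_ofReal (by positivity),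
        ← ENNReal.ofReal_inv_of_pos (Real.exp_pos _), ← ENNReal.ofReal_one,
        ← ENNReal.ofReal_add zero_le_one t.coe_nonneg, ← ENNReal.ofReal_inv_of_pos ht,
        ← ENNReal.ofReal_mul (by positivity), ← ENNReal.ofReal_mul (by positivity)]
      congr 1
      rw [← mul_assoc, inv_mul_cancel₀ ht.ne', one_mul, one_mul, ← Real.exp_neg, ← Real.exp_add]
      ring_nf
  have hmp : Measurable (exponentialPDF 1) :=
    (measurable_exponentialPDFReal 1).ennreal_ofReal
  change ∫⁻ r, _ ∂(volume.withDensity (exponentialPDF 1)) = _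
  rw [lintegral_withDensity_eq_lintegral_mul _ hmp hm]
  simp only [Pi.mul_apply, hpdf]
  have hmt : Measurable (exponentialPDF (1 + t)) :=
    (measurable_exponentialPDFReal _).ennreal_ofReal
  rw [lintegral_const_mul _ hmt,
    lintegral_exponentialPDF_eq_one ht, mul_one]

/-! ### The success probability of a slot -/

/-- The left side is the mean attenuation by one interferer: it misses the desired sub-band with
probability (N - 1)/N and otherwise contributes its Laplace transform. The right side is the
reciprocal form needed for the generating functional. -/
lemma one_sub_add_eq_inv {N : ℕ} (hN : N ≠ 0) (t : ℝ≥0) :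
    ((N : ℝ≥0∞))⁻¹ * ((N - 1 : ℕ) + (1 + t : ℝ≥0∞)⁻¹) =
      (1 + (t : ℝ≥0∞) / (N + (N - 1 : ℕ) * t))⁻¹ := by
  obtain ⟨M, rfl⟩ := Nat.exists_eq_succ_of_ne_zero hN
  have h1 : (((M + 1 : ℕ) : ℝ≥0))⁻¹ * ((M : ℝ≥0) + (1 + t)⁻¹) =
      (1 + t / ((M + 1 : ℕ) + M * t))⁻¹ := by
    have : (0 : ℝ≥0) < (M + 1 : ℕ) + M * t := by positivity
    push_cast at this ⊢
    field_simp
    ring_nf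
  have h2 := congrArg (fun r : ℝ≥0 => (r : ℝ≥0∞)) h1
  have hp : ((M + 1 : ℕ) + M * t : ℝ≥0) ≠ 0 := by positivity
  simp only [ENNReal.coe_mul] at h2
  rw [ENNReal.coe_inv (by positivity), ENNReal.coe_inv (by positivity), ENNReal.coe_add,
    ENNReal.coe_add, ENNReal.coe_inv (by positivity), ENNReal.coe_div hp] at h2
  simpa using h2

section

variable {N : ℕ} (σ : Measure (Fin N))

instance : IsProbabilityMeasure (expMeasure 1) := isProbabilityMeasure_expMeasure one_pos

lemma lintegral_prod_inv_eexp_ite [SFinite σ] (hN : N ≠ 0) (hσ : ∀ s, σ {s} = (N : ℝ≥0∞)⁻¹) (s : Fin N)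
    (t : ℝ≥0) :
    ∫⁻ z, (eexp (if z.2 = s then ENNReal.ofReal z.1 * t else 0))⁻¹ ∂(expMeasure 1).prod σ =
      (1 + (t : ℝ≥0∞) / (N + (N - 1 : ℕ) * t))⁻¹ := by
  have hm : Measurable fun z : ℝ × Fin N =>
      (eexp (if z.2 = s then ENNReal.ofReal z.1 * t else 0))⁻¹ :=
    (measurable_eexp.comp (Measurable.ite (measurable_snd (measurableSet_singleton s))
      ((ENNReal.measurable_ofReal.comp measurable_fst).mul_const _) measurable_const)).inv
  rw [lintegral_prod_symm _ hm.aemeasurable, lintegral_fintype]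
  simp_rw [hσ]
  rw [← Finset.sum_mul, mul_comm, ← one_sub_add_eq_inv hN]
  congr 1
  rw [← Finset.add_sum_erase _ _ (Finset.mem_univ s), add_comm]
  congr 1
  · rw [Finset.sum_congr rfl (g := fun _ => (1 : ℝ≥0∞))]
    · simp
    · intro s' hs'
      simp [Finset.ne_of_mem_erase hs', eexp_zero]
  · simp [lintegral_expMeasure_inv_eexp]

/-- The success probability of a slot, for given positions of the interferers. -/
lemma infinitePi_interference_lt [IsProbabilityMeasure σ] (hN : N ≠ 0) (hσ : ∀ s, σ {s} = (N : ℝ≥0∞)⁻¹) (u : ℝ≥0∞)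
    (t : ℕ → ℝ≥0) :
    (Measure.infinitePi fun _ : ℕ => (expMeasure 1).prod σ)
      {z | u + ∑' i, (if (z (i + 1)).2 = (z 0).2 then ENNReal.ofReal (z (i + 1)).1 * t i else 0) <
        ENNReal.ofReal (z 0).1} =
      (eexp u)⁻¹ * ⨅ n, ∏ i ∈ Finset.range n, (1 + (t i : ℝ≥0∞) / (N + (N - 1 : ℕ) * t i))⁻¹ := by
  set ρ := (expMeasure 1).prod σ with hρ
  set μ := Measure.infinitePi fun _ : ℕ => ρ with hμ
  let T : Fin N → ℕ → ℝ × Fin N → ℝ≥0∞ := fun s i z =>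
    if z.2 = s then ENNReal.ofReal z.1 * t i else 0
  have hT : Measurable fun q : (Fin N × ℕ) × (ℝ × Fin N) => T q.1.1 q.1.2 q.2 := by
    refine Measurable.ite (measurableSet_eq_fun (by fun_prop) (by fun_prop)) ?_ measurable_const
    exact (ENNReal.measurable_ofReal.comp (by fun_prop)).mul
      ((Measurable.of_discrete (f := fun i => (t i : ℝ≥0∞))).comp (by fun_prop))
  have hTs : ∀ s i, Measurable (T s i) := fun s i =>
    hT.comp (f := fun z : ℝ × Fin N => ((s, i), z)) (by fun_prop)
  have hset : MeasurableSet {q : (ℝ × Fin N) × (ℕ → ℝ × Fin N) |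
      u + ∑' i, T q.1.2 i (q.2 i) < ENNReal.ofReal q.1.1} := by
    refine measurableSet_lt (Measurable.const_add (Measurable.tsum fun i => ?_) _)
      (ENNReal.measurable_ofReal.comp (by fun_prop))
    exact hT.comp (f := fun q : (ℝ × Fin N) × (ℕ → ℝ × Fin N) => ((q.1.2, i), q.2 i))
      (by fun_prop)
  have hmap := Measure.map_apply (μ := μ) (f := fun z => (z 0, fun i => z (i + 1)))
    ((measurable_pi_apply 0).prodMk (measurable_pi_iff.2 fun i => measurable_pi_apply (i + 1))) hset
  refine hmap.symm.trans ?_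
  rw [ infinitePi_map_head_tail, Measure.prod_apply_symm hset]
  -- With the interferers' marks fixed, the desired sub-band is summed out and the exponential tail
  -- of the desired fading is evaluated.
  have hfib : ∀ v : ℕ → ℝ × Fin N, ρ ((fun z => (z, v)) ⁻¹' {q : (ℝ × Fin N) × (ℕ → ℝ × Fin N) |
      u + ∑' i, T q.1.2 i (q.2 i) < ENNReal.ofReal q.1.1}) =
      ∑ s, (eexp (u + ∑' i, T s i (v i)))⁻¹ * (N : ℝ≥0∞)⁻¹ := by
    intro v
    rw [hρ, Measure.prod_apply_symm (hset.preimage (by fun_prop)), lintegral_fintype]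
    refine Finset.sum_congr rfl fun s _ => ?_
    rw [hσ, ← expMeasure_lt_ofReal]
    rfl
  simp_rw [hfib]
  have hmT : ∀ s, Measurable fun v : ℕ → ℝ × Fin N => (eexp (u + ∑' i, T s i (v i)))⁻¹ := fun s =>
    (measurable_eexp.comp (Measurable.const_add (Measurable.tsum fun i =>
      (hTs s i).comp (measurable_pi_apply i)) _)).inv
  have hint : ∀ s, ∫⁻ v, (eexp (u + ∑' i, T s i (v i)))⁻¹ ∂μ =
      (eexp u)⁻¹ * ⨅ n, ∏ i ∈ Finset.range n, (1 + (t i : ℝ≥0∞) / (N + (N - 1 : ℕ) * t i))⁻¹ := by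
    intro s
    have hexp : ∀ v : ℕ → ℝ × Fin N, (eexp (u + ∑' i, T s i (v i)))⁻¹ =
        (eexp u)⁻¹ * ⨅ n, ∏ i ∈ Finset.range n, (eexp (T s i (v i)))⁻¹ := by
      intro v
      rw [eexp_add, ENNReal.mul_inv (.inl (eexp_ne_zero _)) (.inr (eexp_ne_zero _)),
        ENNReal.tsum_eq_iSup_nat, eexp_iSup, ENNReal.inv_iSup]
      simp_rw [eexp_sum]
      congr 2
      ext n
      rw [ENNReal.prod_inv_distrib]
      intro i _ j _ _
      exact .inl (eexp_ne_zero _)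
    simp_rw [hexp]
    have hmp : ∀ i, Measurable fun v : ℕ → ℝ × Fin N => (eexp (T s i (v i)))⁻¹ := fun i =>
      (measurable_eexp.comp ((hTs s i).comp (measurable_pi_apply i))).inv
    -- All factors are at most 1, so the partial products decrease from the integrable constant 1
    -- and the integral commutes with the infimum.
    have hanti : Antitone fun n (v : ℕ → ℝ × Fin N) =>
        ∏ i ∈ Finset.range n, (eexp (T s i (v i)))⁻¹ :=
      antitone_nat_of_succ_le fun n v => by
        rw [Finset.prod_range_succ]
        exact mul_le_of_le_one_right' (ENNReal.inv_le_one.2 (one_le_eexp _))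
    rw [lintegral_const_mul _ (Measurable.iInf fun n => Finset.measurable_prod _ fun i _ => hmp i),
      lintegral_iInf (fun n => Finset.measurable_prod _ fun i _ => hmp i) hanti (by simp)]
    · congr 2
      ext n
      rw [lintegral_prod_eq_prod_lintegral_of_indepFun]
      · refine Finset.prod_congr rfl fun i _ => ?_
        rw [← lintegral_prod_inv_eexp_ite σ hN hσ s (t i), ← hρ,
          ← Measure.infinitePi_map_eval (fun _ : ℕ => ρ) i, lintegral_map _ (measurable_pi_apply i)]
        exact (measurable_eexp.comp (hTs s i)).inv
      · exact iIndepFun_infinitePi (X := fun i z => (eexp (T s i z))⁻¹)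
          fun i => (measurable_eexp.comp (hTs s i)).inv
      · exact hmp
  rw [lintegral_finsetSum _ fun s _ => (hmT s).mul_const _, Finset.sum_congr rfl fun s _ => by
    rw [lintegral_mul_const _ (hmT s), hint], Finset.sum_const, Finset.card_univ, Fintype.card_fin,
    nsmul_eq_mul, mul_left_comm, ENNReal.mul_inv_cancel (by exact_mod_cast hN) (by simp), mul_one]

end

/-! ### Radial integrals -/

lemma lintegral_Ioi_exp_neg_mul {a : ℝ} (ha : 0 < a) :
    ∫⁻ s in Set.Ioi (0 : ℝ), ENNReal.ofReal (Real.exp (-a * s)) = ENNReal.ofReal (1 / a) := by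
  rw [← ofReal_integral_eq_lintegral_ofReal (integrableOn_exp_mul_Ioi (neg_lt_zero.2 ha) 0)
    (ae_of_all _ fun s => (Real.exp_pos _).le), integral_exp_mul_Ioi (neg_lt_zero.2 ha)]
  simp

/-- Polar coordinates give d c_d times a Gamma integral equal to b^(-d/α) Γ(d/α) / α; then Γ(1 +
d/α) = (d/α) Γ(d/α). -/
lemma lintegral_exp_neg_mul_norm_rpow {d : ℕ} (hd : 1 ≤ d) {α : ℝ} (hα : 0 < α) {b : ℝ}
    (hb : 0 < b) :
    ∫⁻ y : EuclideanSpace ℝ (Fin d), ENNReal.ofReal (Real.exp (-b * ‖y‖ ^ α)) =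
      ENNReal.ofReal (unitBallVolume d * Real.Gamma (1 + d / α) * b ^ (-(d / α))) := by
  have hd0 : (0 : ℝ) < d := by exact_mod_cast hd
  have : Nonempty (Fin d) := ⟨⟨0, hd⟩⟩
  have hpow : Set.EqOn (fun r : ℝ => r ^ (d - 1) • Real.exp (-b * r ^ α))
      (fun r => r ^ ((d : ℝ) - 1) * Real.exp (-b * r ^ α)) (Set.Ioi 0) := by
    intro r _
    simp only [smul_eq_mul]
    rw [← Real.rpow_natCast, Nat.cast_sub hd, Nat.cast_one]
  have hint : Integrable fun y : EuclideanSpace ℝ (Fin d) => Real.exp (-b * ‖y‖ ^ α) := by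
    rw [integrable_fun_norm_addHaar volume (f := fun r => Real.exp (-b * r ^ α)),
      finrank_euclideanSpace_fin, integrableOn_congr_fun hpow measurableSet_Ioi]
    exact integrableOn_rpow_mul_exp_neg_mul_rpow (by linarith) hα hb
  rw [← ofReal_integral_eq_lintegral_ofReal hint (ae_of_all _ fun s => (Real.exp_pos _).le),
    integral_fun_norm_addHaar volume (fun r => Real.exp (-b * r ^ α)),
    finrank_euclideanSpace_fin, setIntegral_congr_fun measurableSet_Ioi hpow,
    integral_rpow_mul_exp_neg_mul_rpow hα (by linarith) hb, sub_add_cancel, add_comm (1 : ℝ),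
    Real.Gamma_add_one (by positivity)]
  congr 1
  simp only [nsmul_eq_mul, smul_eq_mul, unitBallVolume, neg_div]
  field_simp

/-- Write 1/(1 + q) as the integral of exp(-(1 + q)s) over s > 0 and swap. The inner space integral
is a multiple of s^(-d/α), so the outer one is Γ(1 - d/α), which converges because d < α. -/
lemma lintegral_one_div_one_add_mul_norm_rpow {d : ℕ} (hd : 1 ≤ d) {α : ℝ} (hα : (d : ℝ) < α)
    {b : ℝ} (hb : 0 < b) :
    ∫⁻ y : EuclideanSpace ℝ (Fin d), ENNReal.ofReal (1 / (1 + b * ‖y‖ ^ α)) =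
      ENNReal.ofReal (unitBallVolume d * (Real.Gamma (1 + d / α) * Real.Gamma (1 - d / α)) *
        b ^ (-(d / α))) := by
  have hd0 : (0 : ℝ) < d := by exact_mod_cast hd
  have hα0 : 0 < α := hd0.trans hα
  have hδ : 0 < 1 - d / α := by rw [sub_pos, div_lt_one hα0]; exact hα
  have hV : 0 ≤ unitBallVolume d := measureReal_nonneg
  have hG : 0 ≤ Real.Gamma (1 + d / α) := (Real.Gamma_pos_of_pos (by positivity)).le
  calc ∫⁻ y : EuclideanSpace ℝ (Fin d), ENNReal.ofReal (1 / (1 + b * ‖y‖ ^ α))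
      = ∫⁻ y : EuclideanSpace ℝ (Fin d), ∫⁻ s in Set.Ioi (0 : ℝ),
          ENNReal.ofReal (Real.exp (-(1 + b * ‖y‖ ^ α) * s)) := by
        refine lintegral_congr fun y => ?_
        rw [lintegral_Ioi_exp_neg_mul (by positivity)]
    _ = ∫⁻ s in Set.Ioi (0 : ℝ), ∫⁻ y : EuclideanSpace ℝ (Fin d),
          ENNReal.ofReal (Real.exp (-(1 + b * ‖y‖ ^ α) * s)) := by
        refine lintegral_lintegral_swap (Measurable.aemeasurable ?_)
        refine ENNReal.measurable_ofReal.comp (Real.measurable_exp.comp ?_)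
        refine Measurable.mul (Measurable.neg (Measurable.const_add (Measurable.const_mul ?_ _) _))
          measurable_snd
        exact measurable_fst.norm.pow_const _
    _ = ∫⁻ s in Set.Ioi (0 : ℝ), ENNReal.ofReal (unitBallVolume d * Real.Gamma (1 + d / α) *
          b ^ (-(d / α))) * ENNReal.ofReal (Real.exp (-s) * s ^ (1 - d / α - 1)) := by
        refine setLIntegral_congr_fun measurableSet_Ioi fun s (hs : 0 < s) => ?_
        have : ∀ y : EuclideanSpace ℝ (Fin d),
            ENNReal.ofReal (Real.exp (-(1 + b * ‖y‖ ^ α) * s)) =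
            ENNReal.ofReal (Real.exp (-s)) * ENNReal.ofReal (Real.exp (-(b * s) * ‖y‖ ^ α)) := by
          intro y
          rw [← ENNReal.ofReal_mul (Real.exp_pos _).le, ← Real.exp_add]
          congr 2; ring
        simp only [this]
        rw [lintegral_const_mul' _ _ ENNReal.ofReal_ne_top,
          lintegral_exp_neg_mul_norm_rpow hd hα0 (mul_pos hb hs),
          ← ENNReal.ofReal_mul (Real.exp_pos _).le, ← ENNReal.ofReal_mul (by positivity),
          Real.mul_rpow hb.le hs.le, show 1 - d / α - 1 = -(d / α) by ring]
        congr 1; ring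
    _ = _ := by
        rw [lintegral_const_mul' _ _ ENNReal.ofReal_ne_top,
          ← ofReal_integral_eq_lintegral_ofReal (Real.GammaIntegral_convergent hδ)
            ((ae_restrict_mem measurableSet_Ioi).mono fun s (hs : 0 < s) => by positivity),
          ← Real.Gamma_eq_integral hδ, ← ENNReal.ofReal_mul (by positivity)]
        congr 1; ring

/-- In polar coordinates this is a pure power on (0, ∞), and no power is integrable there. -/
lemma lintegral_norm_rpow_neg_eq_top {d : ℕ} (hd : 1 ≤ d) (α : ℝ) :
    ∫⁻ y : EuclideanSpace ℝ (Fin d), ENNReal.ofReal (‖y‖ ^ (-α)) = ∞ := by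
  by_contra h
  have : Nonempty (Fin d) := ⟨⟨0, hd⟩⟩
  have hint : Integrable fun y : EuclideanSpace ℝ (Fin d) => ‖y‖ ^ (-α) := by
    refine ⟨(measurable_norm.pow_const _).aestronglyMeasurable, ?_⟩
    rw [hasFiniteIntegral_iff_ofReal (ae_of_all _ fun y => by positivity)]
    exact lt_top_iff_ne_top.2 h
  rw [integrable_fun_norm_addHaar volume (f := fun r : ℝ => r ^ (-α)),
    finrank_euclideanSpace_fin] at hint
  refine not_integrableOn_Ioi_rpow ((d : ℝ) - 1 - α)
    ((integrableOn_congr_fun (fun r (hr : 0 < r) => ?_) measurableSet_Ioi).1 hint)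
  rw [smul_eq_mul, ← Real.rpow_natCast, Nat.cast_sub hd, ← Real.rpow_add hr, Nat.cast_one]
  rfl

/-! ### The exponent of the mean local delay -/

/-- Mean received power from a transmitter at `y`, multiplied by the constant `c`. -/
noncomputable def pathGain {d : ℕ} (c : ℝ≥0) (α : ℝ) (y : EuclideanSpace ℝ (Fin d)) : ℝ≥0 :=
  c * ‖y‖₊ ^ (-α)

lemma lintegral_pathGain_div {d : ℕ} (hd : 1 ≤ d) {α : ℝ} (hα : (d : ℝ) < α) {c : ℝ≥0} (hc : 0 < c)
    {N : ℕ} (hN : 2 ≤ N) :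
    ∫⁻ y : EuclideanSpace ℝ (Fin d),
        (pathGain c α y : ℝ≥0∞) / (N + (N - 1 : ℕ) * pathGain c α y) =
      ENNReal.ofReal (unitBallVolume d * (c : ℝ) ^ (d / α) *
        (Real.Gamma (1 + d / α) * Real.Gamma (1 - d / α)) /
        (((N : ℝ) - 1) ^ (1 - d / α) * (N : ℝ) ^ (d / α))) := by
  have hd0 : (0 : ℝ) < d := by exact_mod_cast hd
  have hα0 : 0 < α := hd0.trans hα
  have : Nonempty (Fin d) := ⟨⟨0, hd⟩⟩
  have hN0 : (0 : ℝ) < N := by exact_mod_cast (by omega : 0 < N)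
  have hN1 : (0 : ℝ) < (N : ℝ) - 1 := by
    have : (2 : ℝ) ≤ N := by exact_mod_cast hN
    linarith
  have hc' : (0 : ℝ) < c := hc
  -- The origin is excluded: there `pathGain` has the conventional value 0 and the identity fails,
  -- but a point is a null set for d ≥ 1.
  have hae : ∀ᵐ y : EuclideanSpace ℝ (Fin d),
      (pathGain c α y : ℝ≥0∞) / (N + (N - 1 : ℕ) * pathGain c α y) =
      ENNReal.ofReal (1 / ((N : ℝ) - 1)) *
        ENNReal.ofReal (1 / (1 + N / (((N : ℝ) - 1) * c) * ‖y‖ ^ α)) := by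
    have h0 : ∀ᵐ y : EuclideanSpace ℝ (Fin d), y ≠ 0 := by
      rw [ae_iff]; simp
    filter_upwards [h0] with y hy
    have hr : 0 < ‖y‖ := norm_pos_iff.2 hy
    have hp : (pathGain c α y : ℝ) = c * ‖y‖ ^ (-α) := by simp [pathGain]
    have hpos : (0 : ℝ) < pathGain c α y := by rw [hp]; positivity
    have e1 : (N + (N - 1 : ℕ) * pathGain c α y : ℝ≥0∞) =
        ENNReal.ofReal (N + (N - 1) * pathGain c α y) := by
      rw [ENNReal.ofReal_add hN0.le (by positivity), ENNReal.ofReal_mul hN1.le,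
        ENNReal.ofReal_natCast, ENNReal.ofReal_coe_nnreal, ← Nat.cast_pred (by omega),
        ENNReal.ofReal_natCast]
    rw [e1, ← ENNReal.ofReal_coe_nnreal, ← ENNReal.ofReal_div_of_pos (by positivity),
      ← ENNReal.ofReal_mul (by positivity), hp, Real.rpow_neg hr.le]
    congr 1
    have : 0 < ‖y‖ ^ α := by positivity
    field_simp
    ring
  rw [lintegral_congr_ae hae, lintegral_const_mul' _ _ ENNReal.ofReal_ne_top,
    lintegral_one_div_one_add_mul_norm_rpow hd hα (by positivity),
    ← ENNReal.ofReal_mul (by positivity)]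
  congr 1
  rw [Real.rpow_neg (by positivity), Real.div_rpow hN0.le (by positivity),
    Real.mul_rpow hN1.le hc'.le, Real.rpow_sub hN1, Real.rpow_one]
  field_simp

lemma lintegral_pathGain_eq_top {d : ℕ} (hd : 1 ≤ d) (α : ℝ) {c : ℝ≥0} (hc : 0 < c) :
    ∫⁻ y : EuclideanSpace ℝ (Fin d), (pathGain c α y : ℝ≥0∞) = ∞ := by
  have h : ∀ y : EuclideanSpace ℝ (Fin d), (pathGain c α y : ℝ≥0∞) =
      c * ENNReal.ofReal (‖y‖ ^ (-α)) := by
    intro y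
    rw [pathGain, ENNReal.coe_mul, ← coe_nnnorm, ← NNReal.coe_rpow, ENNReal.ofReal_coe_nnreal]
  simp_rw [h]
  rw [lintegral_const_mul' _ _ ENNReal.coe_ne_top, lintegral_norm_rpow_neg_eq_top hd,
    ENNReal.mul_top (by exact_mod_cast hc.ne')]

/-! ### Local delay and the success event -/

/-- The delay equals the number of n before which fewer than N successes have occurred; if N
successes never occur, every term is 1 and both sides are infinite. Its mean is thus a sum of tail
probabilities. -/
lemma toENNReal_iInf_eq_tsum (p : ℕ → Prop) [DecidablePred p] (N : ℕ) :
    ((⨅ (n : ℕ) (_ : N ≤ Set.ncard {k : ℕ | k < n ∧ p k}), (n : ℕ∞) : ℕ∞) : ℝ≥0∞) =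
      ∑' n, if Nat.count p n < N then 1 else 0 := by
  simp_rw [ncard_lt_and_eq_count]
  by_cases h : ∃ n, N ≤ Nat.count p n
  · classical
    have hlt : ∀ n, Nat.count p n < N ↔ n < Nat.find h := by
      intro n
      rw [Nat.lt_find_iff]
      exact ⟨fun hn m hm => by have := Nat.count_monotone p hm; omega,
        fun hn => not_le.1 (hn n le_rfl)⟩
    have hinf : (⨅ (n : ℕ) (_ : N ≤ Nat.count p n), (n : ℕ∞)) = Nat.find h := by
      refine le_antisymm (iInf₂_le (Nat.find h) (Nat.find_spec h)) (le_iInf₂ fun n hn => ?_)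
      exact_mod_cast Nat.find_min' h hn
    simp_rw [hlt, hinf]
    rw [tsum_eq_sum (s := Finset.range (Nat.find h))
      (fun n hn => if_neg (by simpa using hn)), Finset.sum_congr rfl
      (g := fun _ => 1) (fun n hn => if_pos (Finset.mem_range.1 hn))]
    simp
  · push Not at h
    have hne : ∀ n, ¬ N ≤ Nat.count p n := fun n => not_le.2 (h n)
    simp only [h, hne, if_true, iInf_false, iInf_top, ENat.toENNReal_top]
    exact (ENNReal.tsum_const_eq_top_of_ne_zero one_ne_zero).symm

/-- The set of fading coefficients and sub-bands in one slot for which the slot is successful, when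
the interferers are located at `y 0, y 1, …`. -/
def successSet {d N : ℕ} (x₀ : EuclideanSpace ℝ (Fin d)) (α W N₀ θ : ℝ)
    (y : ℕ → EuclideanSpace ℝ (Fin d)) : Set (ℕ → ℝ × Fin N) :=
  {w | ENNReal.ofReal θ < ENNReal.ofReal (w 0).1 * ‖x₀‖ₑ ^ (-α) /
    (ENNReal.ofReal (W * N₀ / N) + ∑' i, if (w (i + 1)).2 = (w 0).2 then
      ENNReal.ofReal (w (i + 1)).1 * ‖y i‖ₑ ^ (-α) else 0)}

section

variable {d N : ℕ} (x₀ : EuclideanSpace ℝ (Fin d)) (α W N₀ θ : ℝ)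

lemma measurableSet_successSet : MeasurableSet {q : (ℕ → EuclideanSpace ℝ (Fin d)) ×
    (ℕ → ℝ × Fin N) | q.2 ∈ successSet x₀ α W N₀ θ q.1} := by
  refine measurableSet_lt (g := fun q : (ℕ → EuclideanSpace ℝ (Fin d)) × (ℕ → ℝ × Fin N) =>
    ENNReal.ofReal (q.2 0).1 * ‖x₀‖ₑ ^ (-α) / (ENNReal.ofReal (W * N₀ / N) +
      ∑' i, if (q.2 (i + 1)).2 = (q.2 0).2 then
        ENNReal.ofReal (q.2 (i + 1)).1 * ‖q.1 i‖ₑ ^ (-α) else 0))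
    measurable_const (Measurable.div ?_ ?_)
  · exact (ENNReal.measurable_ofReal.comp (by fun_prop)).mul_const _
  · refine Measurable.const_add (Measurable.tsum fun i => ?_) _
    refine Measurable.ite (measurableSet_eq_fun (by fun_prop) (by fun_prop)) ?_ measurable_const
    refine (ENNReal.measurable_ofReal.comp (by fun_prop)).mul (Measurable.pow_const ?_ _)
    exact ((measurable_pi_apply i).comp measurable_fst).enorm

variable {x₀ θ}

lemma successSet_eq (hx₀ : x₀ ≠ 0) (hθ : 0 < θ) {y : ℕ → EuclideanSpace ℝ (Fin d)}
    (hy : ∀ i, y i ≠ 0) :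
    successSet (N := N) x₀ α W N₀ θ y =
      {w | ENNReal.ofReal (θ * ‖x₀‖ ^ α * (W * N₀ / N)) +
        ∑' i, (if (w (i + 1)).2 = (w 0).2 then ENNReal.ofReal (w (i + 1)).1 *
          pathGain (θ * ‖x₀‖ ^ α).toNNReal α (y i) else 0) < ENNReal.ofReal (w 0).1} := by
  ext w
  set c : ℝ := θ * ‖x₀‖ ^ α with hc
  have hn : 0 < ‖x₀‖ := norm_pos_iff.2 hx₀
  have hc0 : 0 < c := by positivity
  have hen : ∀ z : EuclideanSpace ℝ (Fin d), z ≠ 0 → ‖z‖ₑ ^ (-α) = ENNReal.ofReal (‖z‖ ^ (-α)) := by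
    intro z hz
    rw [← ofReal_norm, ENNReal.ofReal_rpow_of_pos (norm_pos_iff.2 hz)]
  have hl0 : ENNReal.ofReal (‖x₀‖ ^ (-α)) ≠ 0 := by
    rw [Ne, ENNReal.ofReal_eq_zero, not_le]; positivity
  have hθc : ENNReal.ofReal θ = ENNReal.ofReal c * ENNReal.ofReal (‖x₀‖ ^ (-α)) := by
    rw [← ENNReal.ofReal_mul hc0.le, hc, mul_assoc, ← Real.rpow_add hn, add_neg_cancel,
      Real.rpow_zero, mul_one]
  have hθ0 : ENNReal.ofReal θ ≠ 0 := by
    rw [Ne, ENNReal.ofReal_eq_zero, not_le]; exact hθ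
  simp only [successSet, Set.mem_ofPred_eq]
  -- Noise plus interference may be 0 or ∞; clearing the denominator is still valid because θ is
  -- finite and nonzero.
  rw [hen x₀ hx₀, ENNReal.lt_div_iff_mul_lt (.inr ENNReal.ofReal_ne_top) (.inr hθ0), hθc,
    mul_right_comm, ENNReal.mul_lt_mul_iff_left hl0 ENNReal.ofReal_ne_top, mul_add,
    ← ENNReal.ofReal_mul hc0.le, ← ENNReal.tsum_mul_left]
  have hterm : ∀ i, (ENNReal.ofReal c * if (w (i + 1)).2 = (w 0).2 then
      ENNReal.ofReal (w (i + 1)).1 * ‖y i‖ₑ ^ (-α) else 0) =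
      if (w (i + 1)).2 = (w 0).2 then ENNReal.ofReal (w (i + 1)).1 *
        pathGain c.toNNReal α (y i) else 0 := by
    intro i
    rw [mul_ite, mul_zero, hen _ (hy i), pathGain, ENNReal.coe_mul, mul_left_comm,
      ← coe_nnnorm, ← NNReal.coe_rpow, ENNReal.ofReal_coe_nnreal]
    rfl
  simp_rw [hterm]

end

/-- A point has volume zero, so its count is Poisson with mean 0. -/
lemma IsPoissonProcess.ae_ne {Ω : Type*} [MeasurableSpace Ω] {d : ℕ}
    {X : ℕ → Ω → EuclideanSpace ℝ (Fin d)} {lam : ℝ≥0} {P : Measure Ω} [IsProbabilityMeasure P]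
    (hX : IsPoissonProcess X lam P) (hd : 1 ≤ d) (a : EuclideanSpace ℝ (Fin d)) :
    ∀ᵐ ω ∂P, ∀ i, X i ω ≠ a := by
  have : Nonempty (Fin d) := ⟨⟨0, hd⟩⟩
  have hv : volume ({a} : Set (EuclideanSpace ℝ (Fin d))) = 0 := measure_singleton a
  have h := hX.count_law {a} (measurableSet_singleton a) (by simp [hv]) 0
  rw [hv, poissonMeasure_singleton] at h
  have hm := measurable_count hX.measurable (measurableSet_singleton a)
  filter_upwards [(mem_ae_iff_prob_eq_one (hm (measurableSet_singleton (0 : ℕ∞)))).2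
    (by simpa using! h)] with ω hω i hi
  have : {i : ℕ | X i ω ∈ ({a} : Set _)} = ∅ := Set.encard_eq_zero.1 hω
  exact (Set.eq_empty_iff_forall_notMem.1 this i) hi

/-! ### Conditioning on the positions -/

namespace IsNetwork

variable {Ω : Type*} [MeasurableSpace Ω] {P : Measure Ω} {d N : ℕ}
  {x : ℕ → Ω → EuclideanSpace ℝ (Fin d)} {h : ℕ → ℕ → Ω → ℝ} {S : ℕ → ℕ → Ω → Fin N}
  {lam : ℝ≥0} {x₀ : EuclideanSpace ℝ (Fin d)}

lemma map_S_eq (hnet : IsNetwork x h S lam x₀ P) (k i : ℕ) : P.map (S k i) = P.map (S 0 0) := by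
  refine Measure.ext_of_singleton fun s => ?_
  rw [Measure.map_apply (hnet.measurable_S _ _) (measurableSet_singleton s),
    Measure.map_apply (hnet.measurable_S _ _) (measurableSet_singleton s)]
  exact (hnet.law_S k i s).trans (hnet.law_S 0 0 s).symm

variable [IsProbabilityMeasure P]

/-- The joint law of the positions and of the fading coefficients and sub-bands. -/
lemma map_positions_prodMk_marks (hnet : IsNetwork x h S lam x₀ P) :
    P.map (fun ω => ((fun i => x (i + 1) ω), fun k i => (h k i ω, S k i ω))) =
      (P.map fun ω i => x (i + 1) ω).prod (Measure.infinitePi fun _ : ℕ =>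
        Measure.infinitePi fun _ : ℕ => (expMeasure 1).prod (P.map (S 0 0))) := by
  have hxm : Measurable fun ω i => x (i + 1) ω := measurable_pi_iff.2 hnet.interferers.measurable
  have hSm := hnet.measurable_S
  have hhm := hnet.measurable_h
  have : IsProbabilityMeasure (P.map (S 0 0)) :=
    Measure.isProbabilityMeasure_map (hSm 0 0).aemeasurable
  have hZm : ∀ p : ℕ × ℕ, Measurable fun ω => (h p.1 p.2 ω, S p.1 p.2 ω) := fun p =>
    (hhm _ _).prodMk (hSm _ _)
  have hind : iIndepFun (fun (p : ℕ × ℕ) ω => (h p.1 p.2 ω, S p.1 p.2 ω)) P :=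
    iIndepFun_prodMk (fun p => hhm _ _) (fun p => hSm _ _) hnet.indep_h hnet.indep_S hnet.indep_h_S
  have hlaw : ∀ p : ℕ × ℕ, P.map (fun ω => (h p.1 p.2 ω, S p.1 p.2 ω)) =
      (expMeasure 1).prod (P.map (S 0 0)) := by
    intro p
    have := hnet.indep_h_S.comp (measurable_pi_apply p) (measurable_pi_apply p)
    have := (indepFun_iff_map_prod_eq_prod_map_map (hhm _ _).aemeasurable
      (hSm _ _).aemeasurable).1 this
    rw [← hnet.law_h p.1 p.2, ← hnet.map_S_eq p.1 p.2]
    exact this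
  rw [← map_curry_eq_infinitePi hZm hind hlaw]
  refine (indepFun_iff_map_prod_eq_prod_map_map hxm.aemeasurable
    (measurable_pi_iff.2 fun k => measurable_pi_iff.2 fun i => hZm (k, i)).aemeasurable).1 ?_
  refine hnet.indep_x.comp (φ := fun y (i : ℕ) => y (i + 1))
    (ψ := fun q (k i : ℕ) => (q.1 (k, i), q.2 (k, i)))
    (measurable_pi_iff.2 fun i => measurable_pi_apply (i + 1)) ?_
  fun_prop

/-- Given the positions, the mean local delay is `N` divided by the success probability. -/
lemma meanLocalDelay_eq_lintegral (hnet : IsNetwork x h S lam x₀ P) (hN : N ≠ 0) (α W N₀ θ : ℝ) :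
    meanLocalDelay x h S P α W N₀ θ = ∫⁻ ω, N * ((Measure.infinitePi fun _ : ℕ =>
      (expMeasure 1).prod (P.map (S 0 0)))
        (successSet x₀ α W N₀ θ fun i => x (i + 1) ω))⁻¹ ∂P := by
  classical
  have : IsProbabilityMeasure (P.map (S 0 0)) :=
    Measure.isProbabilityMeasure_map (hnet.measurable_S 0 0).aemeasurable
  set μ := Measure.infinitePi fun _ : ℕ => (expMeasure 1).prod (P.map (S 0 0)) with hμ
  have hxm : Measurable fun ω i => x (i + 1) ω := measurable_pi_iff.2 hnet.interferers.measurable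
  have hWm : Measurable fun ω (k i : ℕ) => (h k i ω, S k i ω) := measurable_pi_iff.2 fun k =>
    measurable_pi_iff.2 fun i => (hnet.measurable_h k i).prodMk (hnet.measurable_S k i)
  have hs := measurableSet_successSet (N := N) x₀ α W N₀ θ
  let G : (ℕ → EuclideanSpace ℝ (Fin d)) × (ℕ → ℕ → ℝ × Fin N) → ℝ≥0∞ := fun q =>
    ∑' n, if Nat.count (fun k => q.2 k ∈ successSet x₀ α W N₀ θ q.1) n < N then 1 else 0
  have hcount : ∀ n, MeasurableSet {q : (ℕ → EuclideanSpace ℝ (Fin d)) × (ℕ → ℕ → ℝ × Fin N) |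
      Nat.count (fun k => q.2 k ∈ successSet x₀ α W N₀ θ q.1) n < N} := fun n =>
    measurable_natCount (A := fun k => {q : (ℕ → EuclideanSpace ℝ (Fin d)) ×
      (ℕ → ℕ → ℝ × Fin N) | q.2 k ∈ successSet x₀ α W N₀ θ q.1})
      (fun k => hs.preimage (f := fun q : (ℕ → EuclideanSpace ℝ (Fin d)) ×
        (ℕ → ℕ → ℝ × Fin N) => (q.1, q.2 k)) (by fun_prop)) n measurableSet_Iio
  have hG : Measurable G := Measurable.tsum fun n =>
    Measurable.ite (hcount n) measurable_const measurable_const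
  have hdelay : ∀ ω, (localDelay x h S α W N₀ θ ω : ℝ≥0∞) =
      G ((fun i => x (i + 1) ω), fun k i => (h k i ω, S k i ω)) := by
    intro ω
    simp only [G]
    rw [← toENNReal_iInf_eq_tsum]
    simp only [localDelay, sinr, interference, hnet.desired]
    rfl
  rw [meanLocalDelay]
  simp_rw [hdelay]
  rw [← lintegral_map hG (hxm.prodMk hWm), hnet.map_positions_prodMk_marks,
    lintegral_prod _ hG.aemeasurable, lintegral_map hG.lintegral_prod_right' hxm]
  -- From here the positions are frozen, and the slots are the coordinates of a product measure, so
  -- the waiting-time formula applies.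
  refine lintegral_congr fun ω => ?_
  set y : ℕ → EuclideanSpace ℝ (Fin d) := fun i => x (i + 1) ω
  have hsy : MeasurableSet (successSet (N := N) x₀ α W N₀ θ y) :=
    hs.preimage (f := fun w => (y, w)) (by fun_prop)
  have hA : ∀ k, MeasurableSet {z : ℕ → ℕ → ℝ × Fin N | z k ∈ successSet x₀ α W N₀ θ y} :=
    fun k => measurable_pi_apply k hsy
  have hind : iIndepSet (fun k => {z : ℕ → ℕ → ℝ × Fin N | z k ∈ successSet x₀ α W N₀ θ y})
      (Measure.infinitePi fun _ : ℕ => μ) := by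
    rw [iIndepSet_iff_meas_biInter hA]
    intro s
    exact (iIndepFun_infinitePi (P := fun _ : ℕ => μ) (X := fun _ w => w)
      fun _ => measurable_id).measure_inter_preimage_eq_mul s
        (sets := fun _ => successSet x₀ α W N₀ θ y) fun _ _ => hsy
  have hp : ∀ k, (Measure.infinitePi fun _ : ℕ => μ)
      {z : ℕ → ℕ → ℝ × Fin N | z k ∈ successSet x₀ α W N₀ θ y} =
      μ (successSet x₀ α W N₀ θ y) := by
    intro k
    rw [← Measure.infinitePi_map_eval (fun _ : ℕ => μ) k,
      Measure.map_apply (measurable_pi_apply k) hsy, Measure.infinitePi_map_eval]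
    rfl
  rw [← tsum_measure_count_lt hA hind hp hN]
  have hcy : ∀ n, MeasurableSet {z : ℕ → ℕ → ℝ × Fin N |
      Nat.count (fun k => z k ∈ successSet x₀ α W N₀ θ y) n < N} := fun n =>
    (hcount n).preimage (f := fun z => (y, z)) (by fun_prop)
  simp only [G]
  rw [lintegral_tsum fun n => (Measurable.ite (hcy n) measurable_const
    measurable_const).aemeasurable]
  refine tsum_congr fun n => ?_
  rw [← lintegral_indicator_one]
  · refine lintegral_congr fun z => ?_
    simp [Set.indicator_apply]
  · exact hcy n

/-- Inverting the conditional success probability turns its infimum of partial products into a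
supremum of products of 1 + g at the interferers, whose mean is the generating functional. The noise
factor is deterministic. -/
theorem meanLocalDelay_eq (hnet : IsNetwork x h S lam x₀ P) (hN : N ≠ 0) (hd : 1 ≤ d)
    (hx₀ : x₀ ≠ 0) (α W N₀ : ℝ) {θ : ℝ} (hθ : 0 < θ) :
    meanLocalDelay x h S P α W N₀ θ =
      N * (eexp (ENNReal.ofReal (θ * ‖x₀‖ ^ α * (W * N₀ / N))) *
        eexp (lam * ∫⁻ y : EuclideanSpace ℝ (Fin d),
          (pathGain (θ * ‖x₀‖ ^ α).toNNReal α y : ℝ≥0∞) /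
            (N + (N - 1 : ℕ) * pathGain (θ * ‖x₀‖ ^ α).toNNReal α y))) := by
  have : IsProbabilityMeasure (P.map (S 0 0)) :=
    Measure.isProbabilityMeasure_map (hnet.measurable_S 0 0).aemeasurable
  have hσ : ∀ s, P.map (S 0 0) {s} = (N : ℝ≥0∞)⁻¹ := fun s => by
    rw [Measure.map_apply (hnet.measurable_S _ _) (measurableSet_singleton s)]
    exact hnet.law_S 0 0 s
  set c := (θ * ‖x₀‖ ^ α).toNNReal
  have hg : Measurable fun y : EuclideanSpace ℝ (Fin d) =>
      (pathGain c α y : ℝ≥0∞) / (N + (N - 1 : ℕ) * pathGain c α y) := by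
    have : Measurable fun y : EuclideanSpace ℝ (Fin d) => (pathGain c α y : ℝ≥0∞) :=
      ((measurable_nnnorm.pow_const _).const_mul _).coe_nnreal_ennreal
    exact this.div ((this.const_mul _).const_add _)
  have hmeas : Measurable fun ω => ⨆ n, ∏ i ∈ Finset.range n, (1 +
      (pathGain c α (x (i + 1) ω) : ℝ≥0∞) / (N + (N - 1 : ℕ) * pathGain c α (x (i + 1) ω))) :=
    Measurable.iSup fun n => Finset.measurable_prod _ fun i _ =>
      (hg.comp (hnet.interferers.measurable i)).const_add _
  rw [hnet.meanLocalDelay_eq_lintegral hN, ← hnet.interferers.lintegral_iSup_prod hg,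
    ← lintegral_const_mul, ← lintegral_const_mul]
  · refine lintegral_congr_ae ?_
    filter_upwards [hnet.interferers.ae_ne hd 0] with ω hω
    rw [successSet_eq α W N₀ hx₀ hθ hω, infinitePi_interference_lt _ hN hσ, ENNReal.mul_inv,
      inv_inv, ENNReal.inv_iInf]
    · congr 3
      ext n
      rw [← ENNReal.prod_inv_distrib, inv_inv]
      intro i _ j _ _
      exact .inl (by simp)
    · refine .inr ?_
      refine ne_top_of_le_ne_top ?_ (iInf_le _ 0)
      simp
    · refine .inl ?_
      exact ENNReal.inv_ne_top.2 (eexp_ne_zero _)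
  · exact hmeas.const_mul _
  · exact hmeas

end IsNetwork

end FHMA

theorem theorem1 {Ω : Type*} [MeasurableSpace Ω] (P : Measure Ω) [IsProbabilityMeasure P]
    (d : ℕ) (hd : 1 ≤ d) (N : ℕ)
    (lam : ℝ≥0) (hlam : 0 < lam) (α : ℝ) (hα : (d : ℝ) < α)
    (r₀ : ℝ) (hr₀ : 0 < r₀) (x₀ : EuclideanSpace ℝ (Fin d)) (hx₀ : ‖x₀‖ = r₀)
    (W N₀ θ : ℝ) (hW : 0 < W) (hN₀ : 0 ≤ N₀) (hθ : 0 < θ)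
    (x : ℕ → Ω → EuclideanSpace ℝ (Fin d)) (h : ℕ → ℕ → Ω → ℝ) (S : ℕ → ℕ → Ω → Fin N)
    (hnet : FHMA.IsNetwork x h S lam x₀ P)
    (δ A B : ℝ) (hδ : δ = d / α)
    (hA : A = lam * FHMA.unitBallVolume d * r₀ ^ d * θ ^ δ *
      (Real.Gamma (1 + δ) * Real.Gamma (1 - δ)))
    (hB : B = θ * r₀ ^ α * W * N₀) :
    (2 ≤ N → FHMA.meanLocalDelay x h S P α W N₀ θ =
      ENNReal.ofReal
        (N * Real.exp (A / (((N : ℝ) - 1) ^ (1 - δ) * (N : ℝ) ^ δ) + B / N))) ∧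
    (N = 1 → FHMA.meanLocalDelay x h S P α W N₀ θ = ⊤) := by
  have hx0 : x₀ ≠ 0 := norm_pos_iff.1 (hx₀ ▸ hr₀)
  have hd0 : (0 : ℝ) < d := by exact_mod_cast hd
  have hα0 : 0 < α := hd0.trans hα
  have hc : 0 < θ * r₀ ^ α := by positivity
  refine ⟨fun hN => ?_, fun hN => ?_⟩
  · have hN0 : (0 : ℝ) < N := by exact_mod_cast (by omega : 0 < N)
    have hN1 : (0 : ℝ) < (N : ℝ) - 1 := by
      have : (2 : ℝ) ≤ N := by exact_mod_cast hN
      linarith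
    have hδ1 : 0 < 1 - δ := by rw [hδ, sub_pos, div_lt_one hα0]; exact hα
    have hδ0 : 0 < δ := by rw [hδ]; positivity
    have hG : 0 < Real.Gamma (1 + δ) * Real.Gamma (1 - δ) :=
      mul_pos (Real.Gamma_pos_of_pos (by positivity)) (Real.Gamma_pos_of_pos hδ1)
    have hV : 0 ≤ FHMA.unitBallVolume d := measureReal_nonneg
    -- Since αδ = d, the real power of r₀ becomes the natural power r₀^d.
    have hpow : (θ * r₀ ^ α) ^ δ = θ ^ δ * r₀ ^ d := by
      rw [Real.mul_rpow hθ.le (by positivity), ← Real.rpow_mul hr₀.le, hδ,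
        mul_div_cancel₀ _ hα0.ne', Real.rpow_natCast]
    rw [hnet.meanLocalDelay_eq (by omega) hd hx0 α W N₀ hθ, hx₀,
      FHMA.lintegral_pathGain_div hd hα (Real.toNNReal_pos.2 hc) hN, Real.coe_toNNReal _ hc.le,
      ← hδ, hpow, ← ENNReal.ofReal_coe_nnreal, ← ENNReal.ofReal_mul lam.coe_nonneg,
      FHMA.eexp_ofReal (by positivity), FHMA.eexp_ofReal (by positivity),
      ← ENNReal.ofReal_mul (by positivity), ← ENNReal.ofReal_natCast,
      ← ENNReal.ofReal_mul (by positivity), ← Real.exp_add, hA, hB]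
    congr 3
    field_simp
    ring
  · subst hN
    -- With a single sub-band the denominator is 1, so g is the path gain itself and, as λ > 0, the
    -- exponent is infinite.
    have hg : ∀ y : EuclideanSpace ℝ (Fin d),
        (FHMA.pathGain (θ * ‖x₀‖ ^ α).toNNReal α y : ℝ≥0∞) /
          ((1 : ℕ) + (1 - 1 : ℕ) * FHMA.pathGain (θ * ‖x₀‖ ^ α).toNNReal α y) =
        FHMA.pathGain (θ * ‖x₀‖ ^ α).toNNReal α y := by
      intro y; simp
    rw [hnet.meanLocalDelay_eq one_ne_zero hd hx0 α W N₀ hθ, lintegral_congr hg,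
      FHMA.lintegral_pathGain_eq_top hd α (Real.toNNReal_pos.2 (hx₀ ▸ hc)),
      ENNReal.mul_top (by exact_mod_cast hlam.ne'), FHMA.eexp_top,
      ENNReal.mul_top (FHMA.eexp_ne_zero _), Nat.cast_one, one_mul]
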